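/- There is an absolute constant $C$ such that for every $n \in \mathbb{N}$ there exists a finite outerplanar graph $G$ with at most $C\, n^{c}$ vertices, where $c = \log_2(3+\sqrt{10}) \approx 2.623$, that contains every tree on $n$ vertices as a (not necessarily induced) subgraph. Here a finite graph is outerplanar if it can be drawn in the plane without edge crossings so that every vertex lies on the boundary of the outer (unbounded) face. -/

import Mathlib

/-- A crossing-free drawing of a simple graph `G` in the plane `ℝ²`: vertices are distinct points,
every edge `uv` is a simple arc joining the points of `u` and `v`, an edge contains the points of
no vertices other than its two ends, and two distinct edges meet only at the points of common
ends. Only the values of `arc` at edges of `G` matter. -/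
structure PlaneDrawing {V : Type*} (G : SimpleGraph V) where
  /-- the point representing a vertex -/
  point : V → ℝ × ℝ
  /-- the arc representing an edge -/
  arc : Sym2 V → Set (ℝ × ℝ)
  point_injective : Function.Injective point
  arc_isSimpleArc : ∀ u v : V, G.Adj u v →
    ∃ γ : Path (point u) (point v), Function.Injective γ ∧ Set.range γ = arc s(u, v)
  vertex_of_mem_arc : ∀ e ∈ G.edgeSet, ∀ w : V, point w ∈ arc e → w ∈ e
  arc_inter_arc : ∀ e ∈ G.edgeSet, ∀ f ∈ G.edgeSet, e ≠ f →
    ∀ p ∈ arc e ∩ arc f, ∃ w : V, w ∈ e ∧ w ∈ f ∧ point w = p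

/-- The set of all points of the plane that are covered by the drawing. -/
def PlaneDrawing.support {V : Type*} {G : SimpleGraph V} (D : PlaneDrawing G) : Set (ℝ × ℝ) :=
  Set.range D.point ∪ ⋃ e ∈ G.edgeSet, D.arc e

/-- The outer face of a drawing of a finite graph: the points off the drawing whose connected
component in the complement of the drawing is unbounded. (The drawing of a finite graph is compact,
so its complement has exactly one unbounded component.) -/
def PlaneDrawing.outerFace {V : Type*} {G : SimpleGraph V} (D : PlaneDrawing G) : Set (ℝ × ℝ) :=
  {p | p ∈ D.supportᶜ ∧ ¬ Bornology.IsBounded (connectedComponentIn D.supportᶜ p)}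

/-- A finite graph is outerplanar if it has a crossing-free drawing in the plane in which every
vertex lies on the boundary of the outer face. -/
def SimpleGraph.IsOuterplanar {V : Type*} [Finite V] (G : SimpleGraph V) : Prop :=
  ∃ D : PlaneDrawing G, ∀ v : V, D.point v ∈ frontier D.outerFace

/-! Put the vertices on a parabola and draw edges as chords. If no two edges interleave, nothing
crosses, and the region below the parabola makes every vertex outer (`isOuterplanar_of_forall_adj`).
The graphs used are recursively built ordered graphs of this kind (`Edge.not_interleaved`).

Universality is proved by doubling a scale `m` (`IsUniversal.next`). In a tree with fewer than `2m`
vertices, descend from the root into a subtree with at least `m` vertices while there is one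
(`exists_eq_graft`). The path so traversed, without its last vertex but with the forests hanging off
it, has fewer than `m` vertices. Below the last vertex all trees have fewer than `m` vertices, and
they are cut greedily into four forests smaller than `m/2` and three single trees (`hosts_chain`).
Forests and paths are split at their middle tree or middle path vertex.

Let a, h, p be the layout sizes for trees, forests and paths at scale 2^k. Then a' = p + 1 + 4h₀ +
3a, h' = 2h + a' and p' = 2p + 1 + h', where h₀ is the value of h one scale earlier. These grow at
most like (3 + √10)^k (`exists_isUniversal`). -/

/-! ### Outerplanarity of graphs without interleaving edges. -/

/-- The point of the parabola `y = x ^ 2` above a natural number. -/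
def parabolaPoint (i : ℕ) : ℝ × ℝ := ((i : ℝ), (i : ℝ) ^ 2)

theorem parabolaPoint_injective : Function.Injective parabolaPoint := fun i j h => by
  simpa [parabolaPoint] using congrArg Prod.fst h

/-- The height of a chord above the parabola is a product of two linear factors; all comparisons of
chords rest on this identity. -/
theorem mem_segment_parabolaPoint {i j : ℕ} (hij : i < j) {p : ℝ × ℝ}
    (hp : p ∈ segment ℝ (parabolaPoint i) (parabolaPoint j)) :
    (i : ℝ) ≤ p.1 ∧ p.1 ≤ j ∧ p.2 - p.1 ^ 2 = (p.1 - i) * (j - p.1) := by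
  obtain ⟨a, b, ha, hb, hab, rfl⟩ := hp
  have hij' : (i : ℝ) < j := by exact_mod_cast hij
  obtain rfl : a = 1 - b := by linarith
  simp only [parabolaPoint, Prod.fst_add, Prod.smul_fst, Prod.snd_add, Prod.smul_snd, smul_eq_mul]
  refine ⟨by nlinarith, by nlinarith, by ring⟩

theorem eq_parabolaPoint {i j k : ℕ} (hij : i < j) {p : ℝ × ℝ}
    (hp : p ∈ segment ℝ (parabolaPoint i) (parabolaPoint j)) (hk : p.1 = k)
    (h : k = i ∨ k = j) : p = parabolaPoint k := by
  obtain ⟨-, -, h3⟩ := mem_segment_parabolaPoint hij hp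
  refine Prod.ext hk ?_
  have : (p.1 - i) * (j - p.1) = 0 := by
    rcases h with rfl | rfl <;> simp [hk]
  rw [this, hk] at h3
  simp only [parabolaPoint]
  linarith

theorem eq_or_eq_of_parabolaPoint_mem_segment {i j w : ℕ} (hij : i < j)
    (hw : parabolaPoint w ∈ segment ℝ (parabolaPoint i) (parabolaPoint j)) : w = i ∨ w = j := by
  obtain ⟨-, -, h3⟩ := mem_segment_parabolaPoint hij hw
  simp only [parabolaPoint, sub_self, zero_eq_mul, sub_eq_zero] at h3
  rcases h3 with h | h
  · exact Or.inl (by exact_mod_cast h)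
  · exact Or.inr (by exact_mod_cast h.symm)

theorem exists_common_end_of_le {i j k l : ℕ} (hij : i < j) (hkl : k < l) (hik : i ≤ k)
    (hne : ¬ (i = k ∧ j = l)) (hc : i < k → k < j → l ≤ j) {p : ℝ × ℝ}
    (hp : p ∈ segment ℝ (parabolaPoint i) (parabolaPoint j))
    (hq : p ∈ segment ℝ (parabolaPoint k) (parabolaPoint l)) :
    ∃ w, (w = i ∨ w = j) ∧ (w = k ∨ w = l) ∧ parabolaPoint w = p := by
  obtain ⟨h1, h2, h3⟩ := mem_segment_parabolaPoint hij hp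
  obtain ⟨h4, h5, h6⟩ := mem_segment_parabolaPoint hkl hq
  have hlt : (k : ℝ) < l := by exact_mod_cast hkl
  rcases lt_or_ge k j with hkj | hjk
  · rcases hik.eq_or_lt with rfl | hik
    · have hjl : (j : ℝ) - l ≠ 0 := by
        rw [sub_ne_zero]
        exact_mod_cast fun h => hne ⟨rfl, h⟩
      have : (p.1 - i) * ((j : ℝ) - l) = 0 := by linarith
      have hpi : p.1 = i := by
        rcases mul_eq_zero.1 this with h | h
        · linarith
        · exact absurd h hjl
      exact ⟨i, .inl rfl, .inl rfl, (eq_parabolaPoint hij hp hpi (.inl rfl)).symm⟩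
    · have hik' : (i : ℝ) < k := by exact_mod_cast hik
      rcases (hc hik hkj).eq_or_lt with rfl | hlj
      · have : ((k : ℝ) - i) * (l - p.1) = 0 := by linarith
        have hpl : p.1 = l := by
          rcases mul_eq_zero.1 this with h | h <;> linarith
        exact ⟨l, .inr rfl, .inr rfl, (eq_parabolaPoint hij hp hpl (.inr rfl)).symm⟩
      · have hlj' : (l : ℝ) < j := by exact_mod_cast hlj
        -- Strictly nested chords: the outer one is higher by (k - i)(l - x) + (x - i)(j - l) > 0,
        -- where x = `p.1`.
        exfalso
        have e1 : 0 ≤ ((k : ℝ) - i) * (l - p.1) := mul_nonneg (by linarith) (by linarith)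
        have e2 : 0 < (p.1 - i) * ((j : ℝ) - l) := mul_pos (by linarith) (by linarith)
        linarith
  · have hjk' : (j : ℝ) ≤ k := by exact_mod_cast hjk
    obtain rfl : j = k := by
      have : (k : ℝ) ≤ j := by linarith
      exact le_antisymm hjk (by exact_mod_cast this)
    exact ⟨j, .inr rfl, .inl rfl,
      (eq_parabolaPoint hij hp (by linarith) (.inr rfl)).symm⟩

theorem exists_common_end {i j k l : ℕ} (hij : i < j) (hkl : k < l)
    (hne : ¬ (i = k ∧ j = l)) (hc : i < k → k < j → l ≤ j) (hc' : k < i → i < l → j ≤ l)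
    {p : ℝ × ℝ} (hp : p ∈ segment ℝ (parabolaPoint i) (parabolaPoint j))
    (hq : p ∈ segment ℝ (parabolaPoint k) (parabolaPoint l)) :
    ∃ w, (w = i ∨ w = j) ∧ (w = k ∨ w = l) ∧ parabolaPoint w = p := by
  rcases le_total i k with h | h
  · exact exists_common_end_of_le hij hkl h hne hc hp hq
  · obtain ⟨w, h1, h2, h3⟩ :=
      exists_common_end_of_le hkl hij h (fun h => hne ⟨h.1.symm, h.2.symm⟩) hc' hq hp
    exact ⟨w, h2, h1, h3⟩

/-- The chord of the parabola that represents a pair of vertices. -/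
def chord {N : ℕ} : Sym2 (Fin N) → Set (ℝ × ℝ) :=
  Sym2.lift ⟨fun u v => segment ℝ (parabolaPoint u) (parabolaPoint v),
    fun _ _ => segment_symm ℝ _ _⟩

@[simp] theorem chord_mk {N : ℕ} (u v : Fin N) :
    chord s(u, v) = segment ℝ (parabolaPoint u) (parabolaPoint v) := rfl

theorem SimpleGraph.exists_lt_of_mem_edgeSet {α : Type*} [LinearOrder α] {G : SimpleGraph α}
    {e : Sym2 α} (he : e ∈ G.edgeSet) : ∃ u v, u < v ∧ G.Adj u v ∧ e = s(u, v) := by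
  induction e with
  | h u v =>
    rw [SimpleGraph.mem_edgeSet] at he
    rcases lt_or_gt_of_ne he.ne with h | h
    · exact ⟨u, v, h, he, rfl⟩
    · exact ⟨v, u, h, he.symm, Sym2.eq_swap⟩

/-- The straight-line drawing, on a parabola, of a graph on `Fin N` without interleaving edges. -/
def parabolaDrawing {N : ℕ} (G : SimpleGraph (Fin N))
    (hG : ∀ u v u' v', G.Adj u v → G.Adj u' v' → u < u' → u' < v → v' ≤ v) :
    PlaneDrawing G where
  point v := parabolaPoint v
  arc := chord
  point_injective := parabolaPoint_injective.comp Fin.val_injective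
  arc_isSimpleArc u v huv :=
    ⟨Path.segment _ _, Path.segment_injective_of_ne
      (fun h => huv.ne (Fin.val_injective (parabolaPoint_injective h))), Path.range_segment _ _⟩
  vertex_of_mem_arc e he w hw := by
    obtain ⟨u, v, huv, -, rfl⟩ := SimpleGraph.exists_lt_of_mem_edgeSet he
    rcases eq_or_eq_of_parabolaPoint_mem_segment huv hw with h | h
    · simp [Fin.ext h]
    · simp [Fin.ext h]
  arc_inter_arc e he f hf hef p hp := by
    obtain ⟨u, v, huv, h1, rfl⟩ := SimpleGraph.exists_lt_of_mem_edgeSet he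
    obtain ⟨u', v', huv', h2, rfl⟩ := SimpleGraph.exists_lt_of_mem_edgeSet hf
    obtain ⟨w, hw, hw', h⟩ := exists_common_end huv huv'
      (fun h => hef (by rw [Fin.ext h.1, Fin.ext h.2]))
      (fun a b => hG u v u' v' h1 h2 a b)
      (fun a b => hG u' v' u v h2 h1 a b)
      hp.1 hp.2
    obtain ⟨x, rfl⟩ : ∃ x : Fin N, (x : ℕ) = w := by
      rcases hw with rfl | rfl
      · exact ⟨u, rfl⟩
      · exact ⟨v, rfl⟩
    refine ⟨x, ?_, ?_, h⟩
    · rcases hw with h | h <;> simp [Fin.ext h]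
    · rcases hw' with h | h <;> simp [Fin.ext h]

theorem sq_le_of_mem_support_parabolaDrawing {N : ℕ} {G : SimpleGraph (Fin N)}
    {hG : ∀ u v u' v', G.Adj u v → G.Adj u' v' → u < u' → u' < v → v' ≤ v}
    {p : ℝ × ℝ} (hp : p ∈ (parabolaDrawing G hG).support) : p.1 ^ 2 ≤ p.2 := by
  rcases hp with ⟨v, rfl⟩ | hp
  · exact le_rfl
  · simp only [Set.mem_iUnion] at hp
    obtain ⟨e, he, hp⟩ := hp
    obtain ⟨u, v, huv, -, rfl⟩ := SimpleGraph.exists_lt_of_mem_edgeSet he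
    obtain ⟨h1, h2, h3⟩ := mem_segment_parabolaPoint huv hp
    have := mul_nonneg (sub_nonneg.2 h1) (sub_nonneg.2 h2)
    linarith

theorem mem_outerFace_parabolaDrawing {N : ℕ} {G : SimpleGraph (Fin N)}
    {hG : ∀ u v u' v', G.Adj u v → G.Adj u' v' → u < u' → u' < v → v' ≤ v}
    {p : ℝ × ℝ} (hp : p.2 < p.1 ^ 2) : p ∈ (parabolaDrawing G hG).outerFace := by
  set D := parabolaDrawing G hG
  -- The vertical ray going down from `p` avoids the drawing and is unbounded.
  have hsub : (fun t : ℝ => (p.1, t)) '' Set.Iic p.2 ⊆ D.supportᶜ := by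
    rintro _ ⟨t, ht, rfl⟩ hs
    have := sq_le_of_mem_support_parabolaDrawing hs
    simp only [Set.mem_Iic] at this ht
    linarith
  have hconn : IsPreconnected ((fun t : ℝ => (p.1, t)) '' Set.Iic p.2) :=
    isPreconnected_Iic.image _ (by fun_prop)
  have hmem : p ∈ (fun t : ℝ => (p.1, t)) '' Set.Iic p.2 := ⟨p.2, Set.self_mem_Iic, rfl⟩
  refine ⟨hsub hmem, fun hb => ?_⟩
  have hb' := (hb.subset (hconn.subset_connectedComponentIn hmem hsub)).image_snd
  rw [Set.image_image, Set.image_id'] at hb'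
  exact not_bddBelow_Iic p.2 hb'.bddBelow

theorem SimpleGraph.isOuterplanar_of_forall_adj {N : ℕ} (G : SimpleGraph (Fin N))
    (hG : ∀ u v u' v', G.Adj u v → G.Adj u' v' → u < u' → u' < v → v' ≤ v) :
    G.IsOuterplanar := by
  refine ⟨parabolaDrawing G hG, fun v => ⟨?_, fun h => (interior_subset h).1 (.inl ⟨v, rfl⟩)⟩⟩
  have hlim : Filter.Tendsto (fun t : ℝ => ((v : ℝ), (v : ℝ) ^ 2 - t)) (nhdsWithin 0 (Set.Ioi 0))
      (nhds (parabolaPoint v)) := by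
    have : Continuous fun t : ℝ => ((v : ℝ), (v : ℝ) ^ 2 - t) := by fun_prop
    have h := this.tendsto 0
    simp only [sub_zero] at h
    exact h.mono_left nhdsWithin_le_nhds
  refine mem_closure_of_tendsto hlim ?_
  filter_upwards [self_mem_nhdsWithin] with t ht
  refine mem_outerFace_parabolaDrawing ?_
  simp only [Set.mem_Ioi] at ht
  simpa using ht

/-! ### Layouts: ports, edges, planarity. -/

/-- Recipes for vertex-ordered graphs that are drawn with all edges on one side of a line. -/
inductive Layout
  | nil
  /-- A vertex preceded by `L` and followed by `H` and then `R`. -/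
  | node (L H R : Layout)
  | cat (A B : Layout)

namespace Layout

/-- The number of vertices. The vertices of a layout placed at `a` are
`a, a + 1, …, a + size - 1`. -/
def size : Layout → ℕ
  | nil => 0
  | node L H R => L.size + 1 + H.size + R.size
  | cat A B => A.size + B.size

/-- The vertices of a layout placed at `a` that are offered as neighbours to vertices on the
left. -/
def LeftPort : Layout → ℕ → ℕ → Prop
  | nil, _, _ => False
  | node L _ _, a, v => L.LeftPort a v ∨ v = a + L.size
  | cat A B, a, v => A.LeftPort a v ∨ B.LeftPort (a + A.size) v

/-- The vertices of a layout placed at `a` that are offered as neighbours to vertices on the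
right. -/
def RightPort : Layout → ℕ → ℕ → Prop
  | nil, _, _ => False
  | node L H R, a, v => v = a + L.size ∨ R.RightPort (a + L.size + 1 + H.size) v
  | cat _ _, _, _ => False

/-- The edges, directed from left to right, of a layout placed at `a`. -/
def Edge : Layout → ℕ → ℕ → ℕ → Prop
  | nil, _, _, _ => False
  | node L H R, a, u, v =>
    L.Edge a u v ∨ H.Edge (a + L.size + 1) u v ∨ R.Edge (a + L.size + 1 + H.size) u v ∨
      (L.RightPort a u ∧ v = a + L.size) ∨
      (u = a + L.size ∧
        (H.LeftPort (a + L.size + 1) v ∨ R.LeftPort (a + L.size + 1 + H.size) v))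
  | cat A B, a, u, v => A.Edge a u v ∨ B.Edge (a + A.size) u v

theorem LeftPort.bounds {l : Layout} {a v : ℕ} (h : l.LeftPort a v) : a ≤ v ∧ v < a + l.size := by
  induction l generalizing a with
  | nil => exact h.elim
  | node L H R ihL ihH ihR => grind [LeftPort, size]
  | cat A B ihA ihB => grind [LeftPort, size]

theorem RightPort.bounds {l : Layout} {a v : ℕ} (h : l.RightPort a v) :
    a ≤ v ∧ v < a + l.size := by
  induction l generalizing a with
  | nil => exact h.elim
  | node L H R ihL ihH ihR => grind [RightPort, size]
  | cat A B ihA ihB => exact h.elim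

theorem Edge.bounds {l : Layout} {a u v : ℕ} (h : l.Edge a u v) :
    a ≤ u ∧ u < v ∧ v < a + l.size := by
  induction l generalizing a with
  | nil => exact h.elim
  | node L H R ihL ihH ihR => grind [Edge, size, → LeftPort.bounds, → RightPort.bounds]
  | cat A B ihA ihB => grind [Edge, size]

/-- This keeps edges leaving a layout to the left from interleaving with those leaving to the right.
-/
theorem LeftPort.le_rightPort {l : Layout} {a s r : ℕ} (hs : l.LeftPort a s)
    (hr : l.RightPort a r) : s ≤ r := by
  cases l with
  | nil => exact hs.elim
  | node L H R => grind [LeftPort, RightPort, → LeftPort.bounds, → RightPort.bounds]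
  | cat A B => exact hr.elim

/-- No edge passes over a port, so a port can be joined to a vertex outside the layout without
crossing. -/
theorem LeftPort.not_covered {l : Layout} {a s u v : ℕ} (hs : l.LeftPort a s)
    (h : l.Edge a u v) (hu : u < s) : v ≤ s := by
  induction l generalizing a with
  | nil => exact h.elim
  | node L H R ihL ihH ihR =>
    grind [Edge, LeftPort, → LeftPort.bounds, → RightPort.bounds, → Edge.bounds,
      → LeftPort.le_rightPort]
  | cat A B ihA ihB => grind [Edge, LeftPort, → LeftPort.bounds, → Edge.bounds]

theorem RightPort.not_covered {l : Layout} {a s u v : ℕ} (hs : l.RightPort a s)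
    (h : l.Edge a u v) (hu : u < s) : v ≤ s := by
  induction l generalizing a with
  | nil => exact h.elim
  | node L H R ihL ihH ihR =>
    grind [Edge, RightPort, → LeftPort.bounds, → RightPort.bounds, → Edge.bounds,
      → LeftPort.le_rightPort]
  | cat A B ihA ihB => exact hs.elim

theorem Edge.not_interleaved {l : Layout} {a u v u' v' : ℕ} (h : l.Edge a u v)
    (h' : l.Edge a u' v') (hu : u < u') (hv : u' < v) : v' ≤ v := by
  induction l generalizing a with
  | nil => exact h.elim
  | node L H R ihL ihH ihR =>
    simp only [Edge] at h h'
    rcases h with h | h | h | ⟨h, e⟩ | ⟨e, h | h⟩ <;>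
    rcases h' with h' | h' | h' | ⟨h', e'⟩ | ⟨e', h' | h'⟩ <;>
    grind [→ LeftPort.bounds, → RightPort.bounds, → Edge.bounds, → LeftPort.not_covered,
        → RightPort.not_covered]
  | cat A B ihA ihB => grind [Edge, → Edge.bounds]

/-- The graph of a layout placed at `0`. -/
def graph (l : Layout) : SimpleGraph (Fin l.size) where
  Adj u v := l.Edge 0 u v ∨ l.Edge 0 v u
  symm := ⟨fun _ _ h => h.symm⟩
  loopless := ⟨fun _ h => h.elim (fun h => h.bounds.2.1.ne rfl) (fun h => h.bounds.2.1.ne rfl)⟩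

theorem isOuterplanar_graph (l : Layout) : l.graph.IsOuterplanar := by
  refine l.graph.isOuterplanar_of_forall_adj fun u v u' v' h h' hu hv => ?_
  rw [Fin.lt_def] at hu hv
  rw [Fin.le_def]
  rcases h with h | h
  · rcases h' with h' | h'
    · exact h.not_interleaved h' hu hv
    · exact (h'.bounds.2.1.trans hv).le
  · exact absurd (hu.trans hv) h.bounds.2.1.le.not_gt

end Layout

/-! ### Rooted forests, their embeddings and decompositions. -/

/-- Ordered rooted forests: `cons c s` has a first tree, the children of whose root are the roots
of `c`, followed by the trees of `s`. -/
inductive RootedForest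
  | nil
  | cons (c s : RootedForest)

namespace RootedForest

/-- The number of vertices. -/
def size : RootedForest → ℕ
  | nil => 0
  | cons c s => c.size + 1 + s.size

/-- Juxtaposition. -/
def append : RootedForest → RootedForest → RootedForest
  | nil, g => g
  | cons c s, g => cons c (s.append g)

instance : Append RootedForest := ⟨append⟩

@[simp] theorem nil_append (g : RootedForest) : nil ++ g = g := rfl

@[simp] theorem cons_append (c s g : RootedForest) : cons c s ++ g = cons c (s ++ g) := rfl

@[simp] theorem append_nil (f : RootedForest) : f ++ nil = f := by
  induction f with
  | nil => rfl
  | cons c s _ ih => rw [cons_append, ih]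

theorem append_assoc (f g h : RootedForest) : f ++ g ++ h = f ++ (g ++ h) := by
  induction f with
  | nil => rfl
  | cons c s _ ih => rw [cons_append, cons_append, cons_append, ih]

@[simp] theorem size_nil : nil.size = 0 := rfl

@[simp] theorem size_cons (c s : RootedForest) : (cons c s).size = c.size + 1 + s.size := rfl

@[simp] theorem size_append (f g : RootedForest) : (f ++ g).size = f.size + g.size := by
  induction f with
  | nil => simp
  | cons c s _ ih => rw [cons_append, size_cons, size_cons, ih]; ring

/-- Take the first tree at which the running size reaches `m / 2`. -/
theorem exists_eq_append_cons (f : RootedForest) {m : ℕ} (hm : 0 < m) (h : m ≤ 2 * f.size) :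
    ∃ p c q, f = p ++ cons c q ∧ 2 * p.size < m ∧ m ≤ 2 * (p.size + (c.size + 1)) := by
  induction f generalizing m with
  | nil => simp at h; omega
  | cons c s _ ih =>
    by_cases hc : m ≤ 2 * (c.size + 1)
    · exact ⟨nil, c, s, rfl, by simpa using hm, by simpa using hc⟩
    · rw [size_cons] at h
      obtain ⟨p, d, q, rfl, h1, h2⟩ :=
        ih (m := m - 2 * (c.size + 1)) (by omega) (by omega)
      exact ⟨cons c p, d, q, rfl, by rw [size_cons]; omega, by rw [size_cons]; omega⟩

/-- The forest `f` can be found in `G` on vertices of `X` with all roots in `S`. -/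
def Embeds {V : Type*} (G : SimpleGraph V) : RootedForest → Set V → Set V → Prop
  | nil, _, _ => True
  | cons c s, X, S => ∃ x ∈ X, x ∈ S ∧ ∃ X₁ ⊆ X, ∃ X₂ ⊆ X, x ∉ X₁ ∧ x ∉ X₂ ∧ Disjoint X₁ X₂ ∧
      c.Embeds G X₁ (G.neighborSet x) ∧ s.Embeds G X₂ S

variable {V : Type*} {G : SimpleGraph V}

theorem Embeds.mono {f : RootedForest} {X X' S S' : Set V} (h : f.Embeds G X S) (hX : X ⊆ X')
    (hS : ∀ x ∈ X, x ∈ S → x ∈ S') : f.Embeds G X' S' := by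
  induction f generalizing X X' S S' with
  | nil => trivial
  | cons c s _ ih =>
    obtain ⟨x, hx, hxS, X₁, h₁, X₂, h₂, n₁, n₂, hd, hc, hs⟩ := h
    exact ⟨x, hX hx, hS x hx hxS, X₁, h₁.trans hX, X₂, h₂.trans hX, n₁, n₂, hd, hc,
      ih hs subset_rfl fun y hy => hS y (h₂ hy)⟩

theorem Embeds.append {f g : RootedForest} {X Y S : Set V} (hf : f.Embeds G X S)
    (hg : g.Embeds G Y S) (hXY : Disjoint X Y) : (f ++ g).Embeds G (X ∪ Y) S := by
  induction f generalizing X with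
  | nil => exact hg.mono Set.subset_union_right fun _ _ => id
  | cons c s _ ih =>
    obtain ⟨x, hx, hxS, X₁, h₁, X₂, h₂, n₁, n₂, hd, hc, hs⟩ := hf
    refine ⟨x, .inl hx, hxS, X₁, h₁.trans Set.subset_union_left, X₂ ∪ Y,
      Set.union_subset_union_left _ h₂, n₁, ?_, ?_, hc, ih hs (hXY.mono_left h₂)⟩
    · rintro (h | h)
      · exact n₂ h
      · exact Set.disjoint_left.1 hXY hx h
    · exact Set.disjoint_union_right.2 ⟨hd, hXY.mono_left h₁⟩

theorem Embeds.exists_of_append {f g : RootedForest} {X S : Set V} (h : (f ++ g).Embeds G X S) :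
    ∃ X₁ ⊆ X, ∃ X₂ ⊆ X, Disjoint X₁ X₂ ∧ f.Embeds G X₁ S ∧ g.Embeds G X₂ S := by
  induction f generalizing X with
  | nil => exact ⟨∅, Set.empty_subset _, X, subset_rfl, Set.empty_disjoint _, trivial, h⟩
  | cons c s _ ih =>
    obtain ⟨x, hx, hxS, X₁, h₁, X₂, h₂, n₁, n₂, hd, hc, hs⟩ := h
    obtain ⟨Y₁, k₁, Y₂, k₂, hd', hs', hg⟩ := ih hs
    refine ⟨insert x (X₁ ∪ Y₁), Set.insert_subset hx (Set.union_subset h₁ (k₁.trans h₂)), Y₂,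
      k₂.trans h₂, ?_, ?_, hg⟩
    · exact Set.disjoint_insert_left.2 ⟨fun h => n₂ (k₂ h),
        Set.disjoint_union_left.2 ⟨hd.mono_right k₂, hd'⟩⟩
    · exact ⟨x, Set.mem_insert _ _, hxS, X₁,
        Set.subset_union_left.trans (Set.subset_insert _ _), Y₁,
        Set.subset_union_right.trans (Set.subset_insert _ _), n₁, fun h => n₂ (k₁ h),
        hd.mono_right k₁, hc, hs'⟩

/-- The order of the trees is immaterial for embedding, so the two forests beside a path vertex can
be hosted together and the rest of the path inserted between them. -/
theorem Embeds.append_cons {p q c : RootedForest} {X Y S : Set V} (hpq : (p ++ q).Embeds G X S)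
    (hc : (cons c nil).Embeds G Y S) (hXY : Disjoint X Y) :
    (p ++ cons c q).Embeds G (X ∪ Y) S := by
  obtain ⟨X₁, h₁, X₂, h₂, hd, hp, hq⟩ := hpq.exists_of_append
  have h := hp.append (hc.append hq (hXY.mono_left h₂).symm)
    (Set.disjoint_union_right.2 ⟨hXY.mono_left h₁, hd⟩)
  refine h.mono ?_ fun _ _ => id
  exact Set.union_subset (h₁.trans Set.subset_union_left)
    (Set.union_subset Set.subset_union_right (h₂.trans Set.subset_union_left))

theorem Embeds.tree {c : RootedForest} {X : Set V} {x : V} (hx : x ∉ X)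
    (hc : c.Embeds G X (G.neighborSet x)) : (cons c nil).Embeds G (insert x X) {x} :=
  ⟨x, Set.mem_insert _ _, rfl, X, Set.subset_insert _ _, ∅, Set.empty_subset _, hx,
    Set.notMem_empty _, Set.disjoint_empty _, hc, trivial⟩

/-- The forest `c`, hung below a path: the successive vertices of the path are inserted between the
two forests of a pair in the list `hs`. -/
def graft : List (RootedForest × RootedForest) → RootedForest → RootedForest
  | [], c => c
  | h :: hs, c => h.1 ++ cons (graft hs c) h.2

theorem graft_append (l r : List (RootedForest × RootedForest)) (c : RootedForest) :
    graft (l ++ r) c = graft l (graft r c) := by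
  induction l with
  | nil => rfl
  | cons h l ih => rw [List.cons_append, graft, graft, ih]

/-- The number of vertices on a path with hanging forests. -/
def weight : List (RootedForest × RootedForest) → ℕ
  | [] => 0
  | h :: hs => h.1.size + h.2.size + 1 + weight hs

theorem exists_eq_append_cons_of_le_weight (hs : List (RootedForest × RootedForest)) {m : ℕ}
    (hm : 0 < m) (h : m ≤ weight hs) :
    ∃ l d r, hs = l ++ d :: r ∧ weight l < m ∧ m + weight r ≤ weight hs := by
  induction hs generalizing m with
  | nil => rw [weight] at h; omega
  | cons a s ih =>
    rw [weight] at h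
    by_cases hc : m ≤ a.1.size + a.2.size + 1
    · exact ⟨[], a, s, rfl, by simpa [weight] using hm, by rw [weight]; omega⟩
    · obtain ⟨l, d, r, rfl, h1, h2⟩ :=
        ih (m := m - (a.1.size + a.2.size + 1)) (by omega) (by omega)
      exact ⟨a :: l, d, r, rfl, by rw [weight]; omega, by rw [weight]; omega⟩

/-- Weighted median of the path; the forests at the median itself may be almost as large as the
whole. -/
theorem exists_eq_append_cons_of_weight_lt (hs : List (RootedForest × RootedForest)) {m : ℕ}
    (hs0 : hs ≠ []) (h : weight hs < 2 * m) :
    ∃ l d r, hs = l ++ d :: r ∧ weight l < m ∧ weight r < m ∧ d.1.size + d.2.size < 2 * m := by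
  have key : ∀ l d r, hs = l ++ d :: r → d.1.size + d.2.size < 2 * m := by
    rintro l d r rfl
    induction l with
    | nil => simp only [List.nil_append, weight] at h; omega
    | cons a l ih =>
      exact ih (by simp) (by simp only [List.cons_append, weight] at h; omega)
  by_cases hm : m ≤ weight hs
  · obtain ⟨l, d, r, e, h1, h2⟩ := exists_eq_append_cons_of_le_weight hs (m := m) (by omega) hm
    exact ⟨l, d, r, e, h1, by omega, key l d r e⟩
  · cases hs with
    | nil => exact absurd rfl hs0
    | cons d r =>
      refine ⟨[], d, r, rfl, ?_, ?_, key [] d r rfl⟩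
      · rw [weight]; omega
      · rw [weight] at hm; omega

/-- Descend while some child subtree has at least `m` vertices. The whole tree, of `c.size + 1`
vertices, consists of `weight hs` vertices and the last subtree entered, which still has at least
`m`. -/
theorem exists_eq_graft (m : ℕ) (c : RootedForest) :
    ∃ hs e, c = graft hs e ∧ e.size ≤ c.size ∧
      (∀ p d q, e = p ++ cons d q → d.size + 1 < m) ∧
      (hs = [] ∨ weight hs + m ≤ c.size + 1) := by
  induction hn : c.size using Nat.strong_induction_on generalizing c with
  | _ n ih =>
    by_cases hc : ∀ p d q, c = p ++ cons d q → d.size + 1 < m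
    · exact ⟨[], c, rfl, hn.le, hc, .inl rfl⟩
    · push Not at hc
      obtain ⟨p, d, q, rfl, hd⟩ := hc
      simp only [size_append, size_cons] at hn
      obtain ⟨hs, e, rfl, hle, he, h⟩ := ih d.size (by omega) d rfl
      refine ⟨(p, q) :: hs, e, rfl, by omega, he, .inr ?_⟩
      rcases h with rfl | h <;> simp only [weight, graft] at * <;> omega

end RootedForest

/-! ### Universal layouts and their sizes. -/

namespace Layout

open RootedForest

/-- Every graph with the edges of the layout contains the forest, with roots in the left port. -/
def Hosts (l : Layout) (f : RootedForest) : Prop :=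
  ∀ (G : SimpleGraph ℕ) (a : ℕ), (∀ u v, l.Edge a u v → G.Adj u v) →
    f.Embeds G (Set.Ico a (a + l.size)) {v | l.LeftPort a v}

/-- Every graph with the edges of the layout contains the path with hanging forests `hs`, in such a
way that any tree whose root is adjacent to the right port can be appended to the path. -/
def HostsPath (l : Layout) (hs : List (RootedForest × RootedForest)) : Prop :=
  ∀ (G : SimpleGraph ℕ) (a : ℕ), (∀ u v, l.Edge a u v → G.Adj u v) →
    ∀ (Y S : Set ℕ) (c : RootedForest), Disjoint (Set.Ico a (a + l.size)) Y →
      (∀ r s, l.RightPort a r → s ∈ S → G.Adj r s) → (cons c RootedForest.nil).Embeds G Y S →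
      (cons (graft hs c) RootedForest.nil).Embeds G (Set.Ico a (a + l.size) ∪ Y) ({v | l.LeftPort a v} ∪ S)

theorem hosts_nil (l : Layout) : l.Hosts RootedForest.nil := fun _ _ _ => trivial

theorem hostsPath_nil (l : Layout) : l.HostsPath [] := fun _ _ _ _ _ _ _ _ h =>
  h.mono Set.subset_union_right fun _ _ => Or.inr

theorem Hosts.cat {A B : Layout} {f g : RootedForest} (hf : A.Hosts f) (hg : B.Hosts g) :
    (A.cat B).Hosts (f ++ g) := by
  intro G a hE
  have h1 := hf G a fun u v h => hE u v (.inl h)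
  have h2 := hg G (a + A.size) fun u v h => hE u v (.inr h)
  refine ((h1.mono subset_rfl fun _ _ => Or.inl).append (h2.mono subset_rfl fun _ _ => Or.inr)
    ?_).mono ?_ fun _ _ => id
  · rw [Set.disjoint_left]
    intro x hx hx'
    simp only [Set.mem_Ico] at hx hx'
    omega
  · intro x
    simp only [Set.mem_union, Set.mem_Ico, size]
    omega

theorem HostsPath.node {L H R : Layout} {l r : List (RootedForest × RootedForest)}
    {d : RootedForest × RootedForest} (hl : L.HostsPath l) (hd : H.Hosts (d.1 ++ d.2))
    (hr : R.HostsPath r) : (L.node H R).HostsPath (l ++ d :: r) := by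
  intro G a hE Y S c hY hS hc
  have hY' : ∀ x ∈ Y, a ≤ x → a + (L.size + 1 + H.size + R.size) ≤ x := fun x hx hax =>
    le_of_not_gt fun h => Set.disjoint_left.1 hY ⟨hax, h⟩ hx
  have h1 := hr G (a + L.size + 1 + H.size) (fun u v h => hE u v (.inr (.inr (.inl h)))) Y S c
    (by
      rw [Set.disjoint_left]
      intro x hx hx'
      have := hY' x hx'
      simp only [Set.mem_Ico] at hx
      omega)
    (fun u v h => hS u v (.inr h)) hc
  have h2 := hd G (a + L.size + 1) fun u v h => hE u v (.inr (.inl h))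
  -- The centre `a + L.size` carries the path vertex of `d`. It sees the left port of `R` by edges
  -- of the layout, and `S` because it lies in the right port itself.
  have h3 := (h2.mono subset_rfl (S' := G.neighborSet (a + L.size)) fun x _ hx =>
      hE _ _ (.inr (.inr (.inr (.inr ⟨rfl, .inl hx⟩))))).append_cons
    (h1.mono subset_rfl (S' := G.neighborSet (a + L.size)) fun x _ hx =>
      hx.elim (fun hx => hE _ _ (.inr (.inr (.inr (.inr ⟨rfl, .inr hx⟩)))))
        fun hx => hS _ _ (.inl rfl) hx)
    (by
      rw [Set.disjoint_left]
      intro x hx hx'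
      have := hY' x
      simp only [Set.mem_union, Set.mem_Ico] at hx hx'
      grind)
  have h4 := h3.tree (by
    intro hx
    have := hY' (a + L.size)
    simp only [Set.mem_union, Set.mem_Ico] at hx
    grind)
  have h5 := fun hd hadj => hl G a (fun u v h => hE u v (.inl h)) _ _ _ hd hadj h4
  replace h5 := h5
    (by
      rw [Set.disjoint_left]
      intro x hx hx'
      have := hY' x
      simp only [Set.mem_insert_iff, Set.mem_union, Set.mem_Ico] at hx hx'
      grind)
    (fun u v h hv => hE u v (.inr (.inr (.inr (.inl ⟨h, hv⟩)))))
  rw [graft_append, graft]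
  refine h5.mono ?_ fun x _ hx => .inl hx
  intro x
  simp only [Set.mem_insert_iff, Set.mem_union, Set.mem_Ico, size]
  grind

/-- The centre carries the last path vertex, with the bottom forest `e` in `H`. -/
theorem HostsPath.hosts {L H : Layout} {l : List (RootedForest × RootedForest)}
    {e : RootedForest} (hl : L.HostsPath l) (he : H.Hosts e) :
    (L.node H nil).Hosts (cons (graft l e) RootedForest.nil) := by
  intro G a hE
  have h1 := ((he G (a + L.size + 1) fun u v h => hE u v (.inr (.inl h))).mono subset_rfl
    (S' := G.neighborSet (a + L.size)) fun x _ hx =>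
      hE _ _ (.inr (.inr (.inr (.inr ⟨rfl, .inl hx⟩))))).tree
    (by
      intro hx
      simp only [Set.mem_Ico] at hx
      omega)
  have h2 := fun hd hadj => hl G a (fun u v h => hE u v (.inl h)) _ _ _ hd hadj h1
  replace h2 := h2
    (by
      rw [Set.disjoint_left]
      intro x hx hx'
      simp only [Set.mem_insert_iff, Set.mem_Ico] at hx hx'
      omega)
    (fun u v h hv => hE u v (.inr (.inr (.inr (.inl ⟨h, hv⟩)))))
  refine h2.mono ?_ fun x _ hx => hx
  intro x
  simp only [Set.mem_insert_iff, Set.mem_union, Set.mem_Ico, size]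
  omega

/-- Alternating copies of `H` and `A`, with `n` copies of `A`. -/
def chain (H A : Layout) : ℕ → Layout
  | 0 => H
  | n + 1 => H.cat (A.cat (chain H A n))

/-- Each round splits off a forest smaller than `m / 2` and then a tree, together at least `m / 2`.
After `n` rounds fewer than `m / 2` vertices remain. -/
theorem hosts_chain {H A : Layout} {m : ℕ} (hm : 0 < m)
    (hH : ∀ f : RootedForest, 2 * f.size < m → H.Hosts f)
    (hA : ∀ c : RootedForest, c.size + 1 < m → A.Hosts (cons c RootedForest.nil)) (n : ℕ)
    (f : RootedForest) (hf : ∀ p d q, f = p ++ cons d q → d.size + 1 < m)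
    (hn : 2 * f.size < (n + 1) * m) : (chain H A n).Hosts f := by
  induction n generalizing f with
  | zero => exact hH f (by simpa using hn)
  | succ n ih =>
    rw [chain]
    by_cases h : m ≤ 2 * f.size
    · obtain ⟨p, c, q, rfl, h1, h2⟩ := f.exists_eq_append_cons hm h
      refine (hH p h1).cat ((hA c (hf p c q rfl)).cat (ih q ?_ ?_))
      · rintro p' d q' rfl
        exact hf (p ++ cons c p') d q' (by rw [append_assoc, cons_append])
      · simp only [size_append, size_cons] at hn
        have : (n + 1 + 1) * m = (n + 1) * m + m := by ring
        omega
    · rw [← append_nil f]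
      exact (hH f (by omega)).cat (hosts_nil _)

/-- Layouts that are universal at scale `m`: for forests of size below `m / 2`, and for trees,
forests and paths with hanging forests of size below `m`. -/
structure IsUniversal (m : ℕ) (H₀ A H P : Layout) : Prop where
  half : ∀ f : RootedForest, 2 * f.size < m → H₀.Hosts f
  tree : ∀ c : RootedForest, c.size + 1 < m → A.Hosts (cons c RootedForest.nil)
  forest : ∀ f : RootedForest, f.size < m → H.Hosts f
  path : ∀ hs, weight hs < m → P.HostsPath hs

theorem isUniversal_one : IsUniversal 1 nil nil nil nil where
  half f hf := by
    cases f with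
    | nil => exact hosts_nil _
    | cons c s => rw [size_cons] at hf; omega
  tree c hc := by omega
  forest f hf := by
    cases f with
    | nil => exact hosts_nil _
    | cons c s => rw [size_cons] at hf; omega
  path hs h := by
    cases hs with
    | nil => exact hostsPath_nil _
    | cons d hs => rw [weight] at h; omega

/-- The universal layout for trees at the next scale. -/
def nextTree (H₀ A P : Layout) : Layout := P.node (chain H₀ A 3) nil

/-- The universal layout for forests at the next scale. -/
def nextForest (H₀ A H P : Layout) : Layout := H.cat ((nextTree H₀ A P).cat H)

theorem IsUniversal.next {m : ℕ} {H₀ A H P : Layout} (hm : 0 < m)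
    (h : IsUniversal m H₀ A H P) :
    IsUniversal (2 * m) H (nextTree H₀ A P) (nextForest H₀ A H P)
      (P.node (nextForest H₀ A H P) P) := by
  have htree : ∀ c : RootedForest, c.size + 1 < 2 * m →
      (nextTree H₀ A P).Hosts (cons c RootedForest.nil) := by
    intro c hc
    obtain ⟨hs, e, rfl, hle, he, hw⟩ := c.exists_eq_graft m
    refine HostsPath.hosts (h.path hs ?_)
      (hosts_chain hm h.half h.tree 3 e he (by omega))
    rcases hw with rfl | hw
    · rwa [weight]
    · omega
  have hforest : ∀ f : RootedForest, f.size < 2 * m → (nextForest H₀ A H P).Hosts f := by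
    intro f hf
    rw [nextForest]
    by_cases hfm : 2 * m ≤ 2 * f.size
    · obtain ⟨p, c, q, rfl, h1, h2⟩ := f.exists_eq_append_cons (by omega) hfm
      simp only [size_append, size_cons] at hf
      exact (h.forest p (by omega)).cat ((htree c (by omega)).cat (h.forest q (by omega)))
    · rw [← append_nil f]
      exact (h.forest f (by omega)).cat (hosts_nil _)
  refine ⟨fun f hf => h.forest f (by omega), htree, hforest, fun hs hw => ?_⟩
  by_cases hs0 : hs = []
  · rw [hs0]
    exact hostsPath_nil _
  · obtain ⟨l, d, r, rfl, h1, h2, h3⟩ := exists_eq_append_cons_of_weight_lt hs hs0 hw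
    exact (h.path l h1).node (hforest _ (by rwa [size_append])) (h.path r h2)

/-- The constants come from the size recurrences at x = 6.162: 1.481 exceeds x/(x - 2), 2.193
exceeds 1.481·x/(x - 2), and 2.193 + 4·1.481/x + 3 < x. The factor `x` beside `H₀.size` avoids the
exponent k - 1, and `P.size + 1` absorbs the centre vertices. -/
theorem exists_isUniversal {x : ℝ} (hx : 6.162 ≤ x) (k : ℕ) : ∃ H₀ A H P : Layout,
    IsUniversal (2 ^ k) H₀ A H P ∧ (H₀.size : ℝ) * x ≤ 1.481 * x ^ k ∧ (A.size : ℝ) ≤ x ^ k ∧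
      (H.size : ℝ) ≤ 1.481 * x ^ k ∧ (P.size : ℝ) + 1 ≤ 2.193 * x ^ k := by
  induction k with
  | zero => exact ⟨nil, nil, nil, nil, isUniversal_one, by norm_num [size]⟩
  | succ k ih =>
    obtain ⟨H₀, A, H, P, hU, h1, h2, h3, h4⟩ := ih
    have hy : 0 < x ^ k := by positivity
    have e0 : x ^ (k + 1) = x ^ k * x := pow_succ x k
    have e1 : 6.162 * x ^ k ≤ x ^ (k + 1) := by rw [e0, mul_comm]; gcongr
    have h1' : 6.162 * (H₀.size : ℝ) ≤ 1.481 * x ^ k := by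
      refine le_trans ?_ h1
      rw [mul_comm]
      gcongr
    have hA : ((nextTree H₀ A P).size : ℝ) ≤ x ^ (k + 1) := by
      simp only [nextTree, chain, size]
      push_cast
      linarith
    have hH : ((nextForest H₀ A H P).size : ℝ) ≤ 1.481 * x ^ (k + 1) := by
      simp only [nextForest, size] at hA ⊢
      push_cast
      linarith
    refine ⟨_, _, _, _, pow_succ' 2 k ▸ hU.next (by positivity), ?_, hA, hH, ?_⟩
    · rw [e0, ← mul_assoc]
      gcongr
    · simp only [size] at hH ⊢
      push_cast
      linarith

end Layout

/-! ### From trees as graphs to rooted forests. -/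

theorem Function.Injective.optionElim_sumElim {α β γ : Type*} {φ : α → γ} {χ : β → γ} {x : γ}
    (hφ : Function.Injective φ) (hχ : Function.Injective χ) (h₁ : ∀ a, φ a ≠ x)
    (h₂ : ∀ b, χ b ≠ x) (h : ∀ a b, φ a ≠ χ b) :
    Function.Injective fun o : Option (α ⊕ β) => o.elim x (Sum.elim φ χ) := by
  rintro (_ | a | a) (_ | b | b) hab
  · rfl
  · exact absurd hab.symm (h₁ b)
  · exact absurd hab.symm (h₂ b)
  · exact absurd hab (h₁ a)
  · exact congrArg (fun a => some (Sum.inl a)) (hφ hab)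
  · exact absurd hab (h a b)
  · exact absurd hab (h₂ a)
  · exact absurd hab.symm (h b a)
  · exact congrArg (fun a => some (Sum.inr a)) (hχ hab)

namespace RootedForest

/-- The vertices of a rooted forest. -/
def Pos : RootedForest → Type
  | nil => Empty
  | cons c s => Option (c.Pos ⊕ s.Pos)

/-- The roots of a rooted forest. -/
def IsRoot : (f : RootedForest) → f.Pos → Prop
  | nil, _ => False
  | cons _ _, none => True
  | cons _ _, some (.inl _) => False
  | cons _ s, some (.inr b) => s.IsRoot b

/-- The relation between a vertex of a rooted forest and its children. -/
def IsParent : (f : RootedForest) → f.Pos → f.Pos → Prop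
  | nil, _, _ => False
  | cons c _, none, some (.inl a) => c.IsRoot a
  | cons c _, some (.inl a), some (.inl b) => c.IsParent a b
  | cons _ s, some (.inr a), some (.inr b) => s.IsParent a b
  | cons _ _, _, _ => False

theorem Embeds.exists_map {V : Type*} {G : SimpleGraph V} {f : RootedForest} {X S : Set V}
    (h : f.Embeds G X S) : ∃ φ : f.Pos → V, Function.Injective φ ∧ (∀ a, φ a ∈ X) ∧
      (∀ a, f.IsRoot a → φ a ∈ S) ∧ ∀ a b, f.IsParent a b → G.Adj (φ a) (φ b) := by
  induction f generalizing X S with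
  | nil => exact ⟨Empty.elim, fun a => a.elim, fun a => a.elim, fun a => a.elim, fun a => a.elim⟩
  | cons c s ihc ihs =>
    obtain ⟨x, hx, hxS, X₁, h₁, X₂, h₂, n₁, n₂, hd, hc, hs⟩ := h
    obtain ⟨φ, i₁, m₁, r₁, p₁⟩ := ihc hc
    obtain ⟨χ, i₂, m₂, r₂, p₂⟩ := ihs hs
    refine ⟨fun o => Option.elim o x (Sum.elim φ χ), i₁.optionElim_sumElim i₂
      (fun a h => n₁ (h ▸ m₁ a)) (fun a h => n₂ (h ▸ m₂ a))
      (fun a b h => Set.disjoint_left.1 hd (m₁ a) (h ▸ m₂ b)), ?_, ?_, ?_⟩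
    · rintro (_ | a | a)
      · exact hx
      · exact h₁ (m₁ a)
      · exact h₂ (m₂ a)
    · rintro (_ | a | a) h
      · exact hxS
      · exact h.elim
      · exact r₂ a h
    · rintro (_ | a | a) (_ | b | b) h
      all_goals first | exact h.elim | skip
      · exact r₁ b h
      · exact p₁ a b h
      · exact p₂ a b h

/-- The map induced on the vertices of `cons c s` by maps on the vertices of `c` and `s`. -/
def Pos.map {c s c' s' : RootedForest} (φ : c.Pos → c'.Pos) (χ : s.Pos → s'.Pos) :
    (cons c s).Pos → (cons c' s').Pos :=
  Option.map (Sum.map φ χ)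

theorem Pos.map_injective {c s c' s' : RootedForest} {φ : c.Pos → c'.Pos} {χ : s.Pos → s'.Pos}
    (hφ : Function.Injective φ) (hχ : Function.Injective χ) :
    Function.Injective (Pos.map φ χ) :=
  Option.map_injective (hφ.sumMap hχ)

theorem Pos.map_ne_child {c s c' s' : RootedForest} {φ : c.Pos → c'.Pos} {χ : s.Pos → s'.Pos}
    {w : c'.Pos} (hw : ∀ a, φ a ≠ w) (a : (cons c s).Pos) :
    Pos.map φ χ a ≠ (some (.inl w) : Option (c'.Pos ⊕ s'.Pos)) := by
  rcases a with _ | a | a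
  · exact (Option.some_ne_none _).symm
  · exact fun h => hw a (Sum.inl_injective (Option.some_injective _ h))
  · exact fun h => Sum.inr_ne_inl (Option.some_injective _ h)

theorem Pos.map_ne_sibling {c s c' s' : RootedForest} {φ : c.Pos → c'.Pos} {χ : s.Pos → s'.Pos}
    {w : s'.Pos} (hw : ∀ a, χ a ≠ w) (a : (cons c s).Pos) :
    Pos.map φ χ a ≠ (some (.inr w) : Option (c'.Pos ⊕ s'.Pos)) := by
  rcases a with _ | a | a
  · exact (Option.some_ne_none _).symm
  · exact fun h => Sum.inl_ne_inr (Option.some_injective _ h)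
  · exact fun h => hw a (Sum.inr_injective (Option.some_injective _ h))

theorem isRoot_map {c s c' s' : RootedForest} {φ : c.Pos → c'.Pos} {χ : s.Pos → s'.Pos}
    (hχ : ∀ a, s.IsRoot a → s'.IsRoot (χ a)) (a : (cons c s).Pos) (h : (cons c s).IsRoot a) :
    (cons c' s').IsRoot (Pos.map φ χ a) := by
  rcases a with _ | a | a
  exacts [trivial, h.elim, hχ a h]

theorem isParent_map {c s c' s' : RootedForest} {φ : c.Pos → c'.Pos} {χ : s.Pos → s'.Pos}
    (hr : ∀ a, c.IsRoot a → c'.IsRoot (φ a))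
    (hφ : ∀ a b, c.IsParent a b → c'.IsParent (φ a) (φ b))
    (hχ : ∀ a b, s.IsParent a b → s'.IsParent (χ a) (χ b)) (a b : (cons c s).Pos)
    (h : (cons c s).IsParent a b) : (cons c' s').IsParent (Pos.map φ χ a) (Pos.map φ χ b) := by
  rcases a with _ | a | a <;> rcases b with _ | b | b
  all_goals first | exact h.elim | exact hr _ h | exact hφ _ _ h | exact hχ _ _ h

/-- Reattaches a deleted leaf in the induction on trees. -/
theorem exists_insert (f : RootedForest) (v : f.Pos) :
    ∃ (g : RootedForest) (φ : f.Pos → g.Pos) (w : g.Pos), g.size = f.size + 1 ∧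
      Function.Injective φ ∧ (∀ a, φ a ≠ w) ∧ (∀ a, f.IsRoot a → g.IsRoot (φ a)) ∧
      (∀ a b, f.IsParent a b → g.IsParent (φ a) (φ b)) ∧ g.IsParent (φ v) w := by
  induction f with
  | nil => exact v.elim
  | cons c s ihc ihs =>
    rcases v with _ | v | v
    · let φ : c.Pos → (cons nil c).Pos := fun a => some (.inr a)
      have hφ : Function.Injective φ := fun a b h =>
        Sum.inr_injective (Option.some_injective _ h)
      have hw : ∀ a, φ a ≠ (none : Option (nil.Pos ⊕ c.Pos)) := fun a => Option.some_ne_none _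
      exact ⟨cons (cons nil c) s, Pos.map φ id, some (.inl none),
        by simp only [size_cons, size_nil]; ring, Pos.map_injective hφ Function.injective_id,
        Pos.map_ne_child hw, isRoot_map fun _ => id,
        isParent_map (fun _ => id) (fun _ _ => id) fun _ _ => id, trivial⟩
    · obtain ⟨g, φ, w, hg, hi, hw, hr, hp, hv⟩ := ihc v
      exact ⟨cons g s, Pos.map φ id, some (.inl w), by simp only [size_cons, hg]; ring,
        Pos.map_injective hi Function.injective_id, Pos.map_ne_child hw,
        isRoot_map fun _ => id, isParent_map hr hp fun _ _ => id, hv⟩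
    · obtain ⟨g, φ, w, hg, hi, hw, hr, hp, hv⟩ := ihs v
      exact ⟨cons c g, Pos.map id φ, some (.inr w), by simp only [size_cons, hg]; ring,
        Pos.map_injective Function.injective_id hi, Pos.map_ne_sibling hw,
        isRoot_map hr, isParent_map (fun _ => id) (fun _ _ => id) hp, hv⟩

end RootedForest

open RootedForest in
theorem SimpleGraph.IsTree.exists_rootedForest {V : Type*} [Fintype V] {T : SimpleGraph V}
    (hT : T.IsTree) : ∃ f : RootedForest, f.size = Fintype.card V ∧ ∃ ψ : V → f.Pos,
      Function.Injective ψ ∧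
      ∀ u v, T.Adj u v → f.IsParent (ψ u) (ψ v) ∨ f.IsParent (ψ v) (ψ u) := by
  classical
  induction hn : Fintype.card V generalizing V with
  | zero =>
    have := hT.connected.nonempty
    exact absurd hn Fintype.card_ne_zero
  | succ n ih =>
    rcases subsingleton_or_nontrivial V with hV | hV
    · have := hT.connected.nonempty
      refine ⟨cons nil nil, ?_, fun _ => none, Function.injective_of_subsingleton _,
        fun u v h => absurd (Subsingleton.elim u v) h.ne⟩
      have := Fintype.card_le_one_iff_subsingleton.2 hV
      simp only [size_cons, size_nil]
      omega
    · obtain ⟨v, hv⟩ := hT.exists_vert_degree_one_of_nontrivial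
      have hT' : (T.induce {v}ᶜ).IsTree :=
        ⟨hT.connected.induce_compl_singleton_of_degree_eq_one hv, hT.isAcyclic.induce _⟩
      obtain ⟨f, hf, ψ, hi, hp⟩ := ih hT' (by rw [Fintype.card_compl_set]; simp [hn])
      obtain ⟨u, hu, huniq⟩ := degree_eq_one_iff_existsUnique_adj.1 hv
      obtain ⟨g, φ, w, hg, hφ, hw, -, hpar, huw⟩ := f.exists_insert (ψ ⟨u, hu.ne'⟩)
      refine ⟨g, by omega, fun x => if h : x = v then w else φ (ψ ⟨x, h⟩), ?_, ?_⟩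
      · intro x y hxy
        by_cases hx : x = v <;> by_cases hy : y = v <;> simp only [hx, hy, dif_pos, dif_neg,
          not_false_eq_true] at hxy ⊢
        · exact absurd hxy.symm (hw _)
        · exact absurd hxy (hw _)
        · exact congrArg Subtype.val (hi (hφ hxy))
      · intro x y hxy
        by_cases hx : x = v
        · subst hx
          have hy : y ≠ x := hxy.ne'
          obtain rfl := huniq y hxy
          right
          simpa [hy] using huw
        · by_cases hy : y = v
          · subst hy
            obtain rfl := huniq x hxy.symm
            left
            simpa [hx] using huw
          · simp only [hx, hy, dif_neg, not_false_eq_true]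
            exact (hp ⟨x, hx⟩ ⟨y, hy⟩ hxy).imp (hpar _ _) (hpar _ _)

theorem Layout.isContained_graph {l : Layout} {V : Type*} [Fintype V] {T : SimpleGraph V}
    (hT : T.IsTree) (h : ∀ f : RootedForest, f.size = Fintype.card V → l.Hosts f) :
    T.IsContained l.graph := by
  obtain ⟨f, hf, ψ, hψ, hp⟩ := hT.exists_rootedForest
  let G : SimpleGraph ℕ :=
    { Adj := fun u v => l.Edge 0 u v ∨ l.Edge 0 v u
      symm := ⟨fun _ _ h => h.symm⟩
      loopless := ⟨fun _ h =>
        h.elim (fun h => h.bounds.2.1.ne rfl) (fun h => h.bounds.2.1.ne rfl)⟩ }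
  obtain ⟨φ, hφ, hX, -, hadj⟩ := (h f hf G 0 fun u v h => .inl h).exists_map
  have hlt : ∀ a, φ a < l.size := fun a => by simpa using (hX a).2
  exact ⟨⟨⟨fun v => ⟨φ (ψ v), hlt _⟩, fun {u v} huv => (hp u v huv).elim
    (fun h => hadj _ _ h) (fun h => (hadj _ _ h).symm)⟩,
    fun u v huv => hψ (hφ (congrArg Fin.val huv))⟩⟩

theorem mainTheorem1 :
    ∃ C : ℝ, ∀ n : ℕ, ∃ (N : ℕ) (G : SimpleGraph (Fin N)),
      G.IsOuterplanar ∧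
      (N : ℝ) ≤ C * (n : ℝ) ^ Real.logb 2 (3 + Real.sqrt 10) ∧
      ∀ T : SimpleGraph (Fin n), T.IsTree → T.IsContained G := by
  set x : ℝ := 3 + Real.sqrt 10 with hx
  have hx' : 6.162 ≤ x := by
    have : (3.162 : ℝ) ≤ Real.sqrt 10 := Real.le_sqrt_of_sq_le (by norm_num)
    rw [hx]
    linarith
  have hc : 0 < Real.logb 2 x := Real.logb_pos (by norm_num) (by linarith)
  refine ⟨1.481 * x, fun n => ?_⟩
  -- For n = 0 the bound is 0, so the graph must be empty; there is no tree on no vertices.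
  rcases Nat.eq_zero_or_pos n with rfl | hn
  · refine ⟨_, Layout.nil.graph, Layout.nil.isOuterplanar_graph, ?_, fun T hT => ?_⟩
    · rw [Nat.cast_zero, Real.zero_rpow hc.ne']
      simp [Layout.size]
    · exact hT.connected.nonempty.some.elim0
  -- The scale is the least power of two above `n`; rounding up costs the factor `x` in the
  -- constant.
  · obtain ⟨H₀, A, H, P, hU, -, -, hH, -⟩ := Layout.exists_isUniversal hx' (Nat.log 2 n + 1)
    refine ⟨_, H.graph, H.isOuterplanar_graph, hH.trans ?_, fun T hT => ?_⟩
    · rw [pow_succ', ← mul_assoc]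
      gcongr
      calc x ^ Nat.log 2 n = ((2 : ℝ) ^ Nat.log 2 n) ^ Real.logb 2 x := by
            rw [← Real.rpow_natCast 2, ← Real.rpow_mul (by norm_num), mul_comm,
              Real.rpow_mul (by norm_num), Real.rpow_logb (by norm_num) (by norm_num)
              (by linarith), Real.rpow_natCast]
        _ ≤ (n : ℝ) ^ Real.logb 2 x := by
            gcongr
            exact_mod_cast Nat.pow_log_le_self 2 hn.ne'
    · refine Layout.isContained_graph hT fun f hf => hU.forest f ?_
      rw [hf, Fintype.card_fin]
      exact Nat.lt_pow_succ_log_self (by norm_num) n
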